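/- **Setting.** Let $\mathcal Z=\mathcal Z_1\times\mathcal Z_2\subseteq\mathbb R^{d_1}\times\mathbb R^{d_2}$, $\mathcal X\subseteq\mathbb R^{d_x}$, $\mathcal Y\subseteq\mathbb R^{d_y}$, let $l,\psi_1,\dots,\psi_\Xi:\mathcal Z\times\mathcal Y\to\mathbb R$ be measurable in $y$, and let $\alpha_\xi\in(0,1)$. Let $f(z,x,y)$ be a probability density on $\mathcal Z\times\mathcal X\times\mathcal Y$, $f(z,x)=\int_{\mathcal Y}f(z,x,y)\,dy$, and let $f(\cdot\mid z,x)$ be the distribution on $\mathcal Y$ with density $f(z,x,y)/f(z,x)$. For $x\in\mathcal X$ consider the program of minimizing $$L(z\mid x)=\mathbb E_{Y\sim f(\cdot\mid z,x)}[l(z;Y)]\quad\text{over } z\in\mathcal Z\ \text{ with }\ g_\xi(z\mid x)=\mathbb P_{Y\sim f(\cdot\mid z,x)}(\psi_\xi(z;Y)\le 0)\ge 1-\alpha_\xi,\quad \xi=1,\dots,\Xi .$$ Let $(z_i,x_i,y_i)_{i\ge1}$ be random samples, and for every $N\ge 1$ let $w_1,\dots,w_N$ be real weight functions of $(z,x)$,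 which may depend on the samples and on additional randomness. Put $$\hat L^N(z\mid x)=\sum_{i=1}^N w_i(z,x)\,l(z;y_i),\qquad \hat g^N_\xi(z\mid x)=\sum_{i=1}^N w_i(z,x)\,\mathbb I\{\psi_\xi(z;y_i)\le0\},$$ $$\hat P^N(x)=\{z\in\mathcal Z:\hat g^N_\xi(z\mid x)\ge1-\alpha_\xi\ \text{for all }\xi\}.$$ The weights have *strong* (*weak*) uniform consistency if for every $x\in\mathcal X$ the quantities $\sup_{z\in\mathcal Z}|L(z\mid x)-\hat L^N(z\mid x)|$ and $\sup_{z\in\mathcal Z}|g_\xi(z\mid x)-\hat g^N_\xi(z\mid x)|$, $\xi=1,\dots,\Xi$, converge to $0$ as $N\to\infty$ almost surely (in probability). **Assumptions.** 1. (Decomposition and ignorability) There are random variables $Z,X$ and potential outcomes $Y(z)$, $z\in\mathcal Z$, such that $(Z,X,Y(Z))$ has density $f$, $Y(z_1,z_2)=Y(z_1,z_2')$ for all $(z_1,z_2),(z_1,z_2')\in\mathcal Z$, and for every $z\in\mathcal Z$, $Y(z)$ is independent of $Z$ conditionally on $X$. Write $Z=(Z_1,Z_2)$, and write $Y=Y(Z)$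 for the observed outcome. 2. (Continuity) For $h\in\{l,\psi_1,\dots,\psi_\Xi\}$: for all $z\in\mathcal Z$, $y\in\mathcal Y$ and $\epsilon>0$ there is $\delta>0$ with $|h(z;y)-h(z';y)|\le\epsilon$ for all $z'\in\mathcal Z$ with $\|z-z'\|\le\delta$. 3. (Regularity) $\mathcal X,\mathcal Y,\mathcal Z$ are compact; the samples $(z_i,x_i,y_i)$ are i.i.d. with density $f$; $f(z,x,y)$ is continuous with $0<c<f<C$ on $\mathcal Z\times\mathcal X\times\mathcal Y$ for some constants $c,C$; and $f(z,x)$ is twice continuously differentiable on $\mathcal Z\times\mathcal X$. 4. (Existence) For every $x\in\mathcal X$, almost surely $\hat P^N(x)$ is non-empty and compact for all $N\ge1$. 5. (Bounded tails) For some $\lambda>0$, $$\sup_{z\in\mathcal Z,\,x\in\mathcal X}\mathbb E\big[\exp(\lambda|l(z;Y)-\mathbb E[l(z;Y)\mid X=x,Z_1=z_1]|)\,\big|\,X=x,Z_1=z_1\big]<\infty ,$$ where $z=(z_1,z_2)$. 6. (Slater) For every $x\in\mathcal X$ the program has an optimal solution $z^*$ such that for every $\epsilon>0$ there is $z\in\mathcal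 Z$ with $\|z-z^*\|\le\epsilon$ and $g_\xi(z\mid x)>1-\alpha_\xi$ for all $\xi$. Suppose moreover that $(z,x)\mapsto f(\cdot\mid z,x)$ is Lipschitz on $\mathcal Z\times\mathcal X$ for the 1-Wasserstein distance, and that for some $M<\infty$ and all $z\in\mathcal Z$, $x\in\mathcal X$ and $\xi$, the variable $\psi_\xi(z;Y)$ with $Y\sim f(\cdot\mid z,x)$ has a density bounded by $M$. **Theorem.** If the weights have strong (respectively weak) uniform consistency, then for every $x\in\mathcal X$ there are an optimal solution $z^*$ of the program and a sequence of random points $z^N$ with, almost surely, $z^N\in\hat P^N(x)$ for all $N\ge1$, such that, as $N\to\infty$, almost surely (respectively in probability): 1. (Accuracy) $z^N\to z^*$ and $\hat L^N(z^N\mid x)\to L(z^*\mid x)$; 2. (Optimality) $L(z^N\mid x)\to L(z^*\mid x)$. -/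

import Mathlib

open MeasureTheory ProbabilityTheory Filter Topology Set
open scoped ENNReal NNReal

noncomputable section

namespace CCDDU

/-- Decisions `z = (z₁, z₂)`. -/
abbrev Dec (d₁ d₂ : ℕ) : Type :=
  EuclideanSpace ℝ (Fin d₁) × EuclideanSpace ℝ (Fin d₂)

/-- Contexts. -/
abbrev Ctx (dx : ℕ) : Type := EuclideanSpace ℝ (Fin dx)

/-- Outcomes. -/
abbrev Out (dy : ℕ) : Type := EuclideanSpace ℝ (Fin dy)

/-- The data of a contextual chance-constrained program with decision-dependent uncertainty.
Only the values of `loss`, `con` and `dens` on the sets below matter. -/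
structure Problem (d₁ d₂ dx dy Ξ : ℕ) where
  /-- value space of the uncertainty-affecting decision `z₁` -/
  Z₁ : Set (EuclideanSpace ℝ (Fin d₁))
  /-- value space of the uncertainty-independent decision `z₂` -/
  Z₂ : Set (EuclideanSpace ℝ (Fin d₂))
  /-- context space -/
  X : Set (Ctx dx)
  /-- outcome space -/
  Y : Set (Out dy)
  /-- the loss `l(z; y)` -/
  loss : Dec d₁ d₂ → Out dy → ℝ
  /-- the constraint functions `ψ_ξ(z; y)` -/
  con : Fin Ξ → Dec d₁ d₂ → Out dy → ℝ
  /-- the risk levels `α_ξ` -/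
  risk : Fin Ξ → ℝ
  /-- the joint density `f(z, x, y)` of decision, context and outcome -/
  dens : Dec d₁ d₂ → Ctx dx → Out dy → ℝ

variable {d₁ d₂ dx dy Ξ : ℕ} {Ω : Type*} [MeasurableSpace Ω]

namespace Problem

variable (p : Problem d₁ d₂ dx dy Ξ)

/-- The decision space `Z = Z₁ × Z₂`. -/
def Z : Set (Dec d₁ d₂) := p.Z₁ ×ˢ p.Z₂

/-- The joint distribution with density `f(z, x, y)` with respect to Lebesgue measure on
`Z × X × Y`. -/
def jointLaw : Measure (Dec d₁ d₂ × Ctx dx × Out dy) :=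
  (volume.restrict (p.Z ×ˢ p.X ×ˢ p.Y)).withDensity
    fun q => ENNReal.ofReal (p.dens q.1 q.2.1 q.2.2)

/-- The marginal density `f(z, x) = ∫ f(z, x, y) dy`. -/
def marg (z : Dec d₁ d₂) (x : Ctx dx) : ℝ := ∫ y in p.Y, p.dens z x y

/-- The conditional distribution `f(· ∣ z, x)` of the outcome given `Z = z` and `X = x`. -/
def condLaw (z : Dec d₁ d₂) (x : Ctx dx) : Measure (Out dy) :=
  (volume.restrict p.Y).withDensity fun y => ENNReal.ofReal (p.dens z x y / p.marg z x)

/-- The conditional distribution of the outcome given `Z₁ = z₁` and `X = x`. -/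
def condLaw₁ (z₁ : EuclideanSpace ℝ (Fin d₁)) (x : Ctx dx) : Measure (Out dy) :=
  (volume.restrict p.Y).withDensity fun y =>
    ENNReal.ofReal ((∫ z₂ in p.Z₂, p.dens (z₁, z₂) x y) / ∫ z₂ in p.Z₂, p.marg (z₁, z₂) x)

/-- The true objective `L(z ∣ X = x)`. -/
def L (z : Dec d₁ d₂) (x : Ctx dx) : ℝ := ∫ y, p.loss z y ∂(p.condLaw z x)

/-- The true chance function `g_ξ(z ∣ X = x)`. -/
def g (ξ : Fin Ξ) (z : Dec d₁ d₂) (x : Ctx dx) : ℝ :=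
  (p.condLaw z x).real {y | p.con ξ z y ≤ 0}

/-- The feasible set of the true program in the context `x`. -/
def feasible (x : Ctx dx) : Set (Dec d₁ d₂) :=
  {z | z ∈ p.Z ∧ ∀ ξ, 1 - p.risk ξ ≤ p.g ξ z x}

/-- `z` is an optimal solution of the true program in the context `x`. -/
def IsOptimal (x : Ctx dx) (z : Dec d₁ d₂) : Prop :=
  z ∈ p.feasible x ∧ ∀ z' ∈ p.feasible x, p.L z x ≤ p.L z' x

end Problem

/-- A dataset: the `i`-th sample is `(z_i, x_i, y_i)`. -/
abbrev Data (d₁ d₂ dx dy : ℕ) (Ω : Type*) : Type _ :=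
  ℕ → Ω → Dec d₁ d₂ × Ctx dx × Out dy

/-- Weight functions: `w N i ω z x` is the weight `w_i(z, x)` of the `i`-th of `N` samples.
It may depend on the realized dataset and on additional randomness (as for random trees). -/
abbrev Weights (d₁ d₂ dx : ℕ) (Ω : Type*) : Type _ :=
  (N : ℕ) → Fin N → Ω → Dec d₁ d₂ → Ctx dx → ℝ

namespace Problem

variable (p : Problem d₁ d₂ dx dy Ξ)

/-- The approximate objective `L̂(z ∣ X = x) = ∑ w_i(z, x) l(z; y_i)` from `N` samples. -/
def Lhat (S : Data d₁ d₂ dx dy Ω) (w : Weights d₁ d₂ dx Ω) (N : ℕ) (ω : Ω)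
    (z : Dec d₁ d₂) (x : Ctx dx) : ℝ :=
  ∑ i : Fin N, w N i ω z x * p.loss z (S i ω).2.2

/-- The approximate chance function `ĝ_ξ(z ∣ X = x) = ∑ w_i(z, x) 𝟙{ψ_ξ(z, y_i) ≤ 0}`. -/
def ghat (S : Data d₁ d₂ dx dy Ω) (w : Weights d₁ d₂ dx Ω) (ξ : Fin Ξ) (N : ℕ) (ω : Ω)
    (z : Dec d₁ d₂) (x : Ctx dx) : ℝ :=
  ∑ i : Fin N, w N i ω z x * {y | p.con ξ z y ≤ 0}.indicator (fun _ => (1 : ℝ)) (S i ω).2.2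

/-- The approximate feasible set `P̂(x)` from `N` samples. -/
def Phat (S : Data d₁ d₂ dx dy Ω) (w : Weights d₁ d₂ dx Ω) (N : ℕ) (ω : Ω) (x : Ctx dx) :
    Set (Dec d₁ d₂) :=
  {z | z ∈ p.Z ∧ ∀ ξ, 1 - p.risk ξ ≤ p.ghat S w ξ N ω z x}

/-- `sup_{z ∈ Z} |h z - h' z|`, as an extended nonnegative number. -/
def supDist (h h' : Dec d₁ d₂ → ℝ) : ℝ≥0∞ :=
  ⨆ z ∈ p.Z, ENNReal.ofReal |h z - h' z|

/-- Strong uniform(-in-decision) consistency of the approximations `est N` of `target`. -/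
def StrongUC (P : Measure Ω) (target : Dec d₁ d₂ → Ctx dx → ℝ)
    (est : ℕ → Ω → Dec d₁ d₂ → Ctx dx → ℝ) : Prop :=
  ∀ x ∈ p.X, ∀ᵐ ω ∂P,
    Tendsto (fun N => p.supDist (fun z => target z x) (fun z => est N ω z x)) atTop (𝓝 0)

/-- Weak uniform(-in-decision) consistency: the same with convergence in probability. -/
def WeakUC (P : Measure Ω) (target : Dec d₁ d₂ → Ctx dx → ℝ)
    (est : ℕ → Ω → Dec d₁ d₂ → Ctx dx → ℝ) : Prop :=
  ∀ x ∈ p.X, ∀ ε : ℝ≥0∞, 0 < ε →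
    Tendsto (fun N => P {ω | ε ≤ p.supDist (fun z => target z x) (fun z => est N ω z x)})
      atTop (𝓝 0)

/-- The weights have strong uniform consistency, for the objective and for all constraints. -/
def StrongWeights (P : Measure Ω) (S : Data d₁ d₂ dx dy Ω) (w : Weights d₁ d₂ dx Ω) : Prop :=
  p.StrongUC P p.L (p.Lhat S w) ∧ ∀ ξ, p.StrongUC P (p.g ξ) (p.ghat S w ξ)

/-- The weights have weak uniform consistency, for the objective and for all constraints. -/
def WeakWeights (P : Measure Ω) (S : Data d₁ d₂ dx dy Ω) (w : Weights d₁ d₂ dx Ω) : Prop :=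
  p.WeakUC P p.L (p.Lhat S w) ∧ ∀ ξ, p.WeakUC P (p.g ξ) (p.ghat S w ξ)

end Problem

/-- `U` and `V` are conditionally independent given the random variable `W`. -/
def CondIndepGiven {α β γ : Type*} [MeasurableSpace α] [MeasurableSpace β] [MeasurableSpace γ]
    (P : Measure Ω) (U : Ω → α) (V : Ω → β) (W : Ω → γ) : Prop :=
  ∀ A B, MeasurableSet A → MeasurableSet B →
    P⟦U ⁻¹' A ∩ V ⁻¹' B | MeasurableSpace.comap W inferInstance⟧ =ᵐ[P]
      P⟦U ⁻¹' A | MeasurableSpace.comap W inferInstance⟧ *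
        P⟦V ⁻¹' B | MeasurableSpace.comap W inferInstance⟧

/-- The 1-Wasserstein distance: the infimum of the transport cost over all couplings. -/
def W1 {E : Type*} [MeasurableSpace E] [EDist E] (μ ν : Measure E) : ℝ≥0∞ :=
  ⨅ (γ : Measure (E × E)) (_ : γ.map Prod.fst = μ) (_ : γ.map Prod.snd = ν),
    ∫⁻ q, edist q.1 q.2 ∂γ

namespace Problem

variable (p : Problem d₁ d₂ dx dy Ξ)

/-- Decomposition and ignorability, for the historical decision `Zr`, the context `Xr` and the
potential outcomes `Yr z`; the observed outcome is `Yr Zr`. -/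
structure DecompIgn (P : Measure Ω) (Zr : Ω → Dec d₁ d₂) (Xr : Ω → Ctx dx)
    (Yr : Dec d₁ d₂ → Ω → Out dy) : Prop where
  measurable_Z : Measurable Zr
  measurable_X : Measurable Xr
  measurable_Y : ∀ z ∈ p.Z, Measurable (Yr z)
  observed : P.map (fun ω => (Zr ω, Xr ω, Yr (Zr ω) ω)) = p.jointLaw
  decomp : ∀ z₁ ∈ p.Z₁, ∀ z₂ ∈ p.Z₂, ∀ z₂' ∈ p.Z₂, Yr (z₁, z₂) = Yr (z₁, z₂')
  ignorability : ∀ z ∈ p.Z, CondIndepGiven P (Yr z) Zr Xr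

/-- Continuity in the decision of a function of decision and outcome; `δ` may depend on `y`. -/
def EquiCont (h : Dec d₁ d₂ → Out dy → ℝ) : Prop :=
  ∀ z ∈ p.Z, ∀ y ∈ p.Y, ∀ ε > 0, ∃ δ > 0, ∀ z' ∈ p.Z, ‖z - z'‖ ≤ δ → |h z y - h z' y| ≤ ε

/-- Loss and constraint functions are measurable in the outcome. -/
def MeasurableData : Prop :=
  (∀ z ∈ p.Z, Measurable fun y : p.Y => p.loss z y) ∧
    ∀ ξ, ∀ z ∈ p.Z, Measurable fun y : p.Y => p.con ξ z y

/-- Regularity. -/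
structure Regular (P : Measure Ω) (S : Data d₁ d₂ dx dy Ω) : Prop where
  compact_X : IsCompact p.X
  compact_Y : IsCompact p.Y
  compact_Z : IsCompact p.Z
  measurable_S : ∀ i, Measurable (S i)
  law_S : ∀ i, P.map (S i) = p.jointLaw
  indep_S : iIndepFun S P
  dens_continuous :
    ContinuousOn (fun q : Dec d₁ d₂ × Ctx dx × Out dy => p.dens q.1 q.2.1 q.2.2)
      (p.Z ×ˢ p.X ×ˢ p.Y)
  dens_bounds : ∃ c C : ℝ, 0 < c ∧ ∀ z ∈ p.Z, ∀ x ∈ p.X, ∀ y ∈ p.Y,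
    c < p.dens z x y ∧ p.dens z x y < C
  marg_smooth : ContDiffOn ℝ 2 (fun q : Dec d₁ d₂ × Ctx dx => p.marg q.1 q.2) (p.Z ×ˢ p.X)

/-- Existence: the approximate feasible sets are almost surely non-empty and compact. -/
def Existence (P : Measure Ω) (S : Data d₁ d₂ dx dy Ω) (w : Weights d₁ d₂ dx Ω) : Prop :=
  ∀ x ∈ p.X, ∀ᵐ ω ∂P, ∀ N ≥ 1, (p.Phat S w N ω x).Nonempty ∧ IsCompact (p.Phat S w N ω x)

/-- Bounded tails. -/
def BoundedTails : Prop :=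
  ∃ lam : ℝ, 0 < lam ∧
    (⨆ z ∈ p.Z, ⨆ x ∈ p.X,
      ∫⁻ y, ENNReal.ofReal
        (Real.exp (lam * |p.loss z y - ∫ y', p.loss z y' ∂(p.condLaw₁ z.1 x)|))
        ∂(p.condLaw₁ z.1 x)) < ∞

/-- Slater condition. -/
def Slater : Prop :=
  ∀ x ∈ p.X, ∃ zs, p.IsOptimal x zs ∧
    ∀ ε > 0, ∃ z ∈ p.Z, ‖z - zs‖ ≤ ε ∧ ∀ ξ, 1 - p.risk ξ < p.g ξ z x

/-- The map `(z, x) ↦ f(· ∣ z, x)` is Lipschitz for the 1-Wasserstein distance. -/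
def WassersteinLipschitz : Prop :=
  ∃ Lf : ℝ≥0, ∀ z ∈ p.Z, ∀ x ∈ p.X, ∀ z' ∈ p.Z, ∀ x' ∈ p.X,
    W1 (p.condLaw z x) (p.condLaw z' x') ≤ Lf * edist (z, x) (z', x')

/-- For `Y ∼ f(· ∣ z, x)`, the variables `ψ_ξ(z, Y)` have uniformly bounded Lebesgue densities. -/
def BoundedDensities : Prop :=
  ∃ M : ℝ≥0, ∀ z ∈ p.Z, ∀ x ∈ p.X, ∀ ξ, ∃ ρ : ℝ → ℝ≥0∞, Measurable ρ ∧ (∀ t, ρ t ≤ M) ∧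
    (p.condLaw z x).map (p.con ξ z) = volume.withDensity ρ

end Problem

end CCDDU

end

/-! The Slater solution `z*` is a limit of strictly feasible decisions. Each of these has positive
slack in finitely many constraints, so it lies in the approximate feasible set once the uniform
errors are below that slack. Hence the distance from `z*` to the approximate feasible set tends to
`0`, and nearly closest points `z^N` converge to `z*`. Continuity of `L` gives `L(z^N) → L(z*)`, and
the uniform error of the objective transfers this to the estimates (`exists_controlled_selection`).
The argument is deterministic: closeness follows from small errors at each outcome. `ControlledBy`
records this, so one selection serves both modes of convergence.

The analytic part is continuity of `L` (`Regular.continuousOn_L`), where the loss may be unbounded.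
Density bounds make the laws given `Z₁` dominate a multiple of Lebesgue measure on `Y`, so the tail
condition bounds exponential moments of the centered loss under Lebesgue measure. Along a convergent
sequence of decisions the losses converge pointwise, and Fatou's lemma forbids unbounded centerings.
This bounds the losses in `L²`, and Vitali's theorem applies. -/

namespace CCDDU

/-! ### Convergence of integrals under exponential moment bounds -/

section Integration

variable {α : Type*} [MeasurableSpace α] {ν : Measure α}

/-- Vitali convergence for real functions that are bounded in `L²`. -/
theorem tendsto_integral_of_sq_lintegral_le [IsFiniteMeasure ν] {b : ℕ → α → ℝ} {b' : α → ℝ}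
    (hb : ∀ n, AEStronglyMeasurable (b n) ν)
    (hlim : ∀ᵐ y ∂ν, Tendsto (fun n => b n y) atTop (𝓝 (b' y)))
    {K : ℝ≥0∞} (hK : K ≠ ∞) (hle : ∀ n, ∫⁻ y, ENNReal.ofReal (b n y ^ 2) ∂ν ≤ K) :
    Tendsto (fun n => ∫ y, b n y ∂ν) atTop (𝓝 (∫ y, b' y ∂ν)) := by
  have hui : UniformIntegrable b 1 ν := by
    refine uniformIntegrable_of le_rfl ENNReal.one_ne_top hb fun ε hε => ?_
    -- On `|b| ≥ C` one has `|b| ≤ b² / C`, so the tail integral is at most `K / C ≤ ε`; the `+ 1`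
    -- keeps `C` positive when `K = 0`.
    set C : ℝ := (K.toReal + 1) / ε with hC
    have hK0 : 0 ≤ K.toReal := ENNReal.toReal_nonneg
    have hCpos : 0 < C := by positivity
    refine ⟨⟨C, hCpos.le⟩, fun n => ?_⟩
    rw [eLpNorm_one_eq_lintegral_enorm]
    calc ∫⁻ y, ‖{y | (⟨C, hCpos.le⟩ : ℝ≥0) ≤ ‖b n y‖₊}.indicator (b n) y‖ₑ ∂ν
        ≤ ∫⁻ y, ENNReal.ofReal C⁻¹ * ENNReal.ofReal (b n y ^ 2) ∂ν := by
          refine lintegral_mono fun y => ?_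
          by_cases hy : y ∈ {y | (⟨C, hCpos.le⟩ : ℝ≥0) ≤ ‖b n y‖₊}
          · have hy' : C ≤ |b n y| := by
              have : (⟨C, hCpos.le⟩ : ℝ≥0) ≤ ‖b n y‖₊ := hy
              exact_mod_cast this
            rw [indicator_of_mem hy, Real.enorm_eq_ofReal_abs,
              ← ENNReal.ofReal_mul (inv_nonneg.2 hCpos.le)]
            refine ENNReal.ofReal_le_ofReal ?_
            rw [← sq_abs, inv_mul_eq_div, le_div_iff₀ hCpos, sq]
            exact mul_le_mul_of_nonneg_left hy' (abs_nonneg _)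
          · rw [indicator_of_notMem hy]
            simp
      _ ≤ ENNReal.ofReal C⁻¹ * K := by
          rw [lintegral_const_mul' _ _ ENNReal.ofReal_ne_top]
          gcongr
          exact hle n
      _ ≤ ENNReal.ofReal ε := by
          rw [← ENNReal.ofReal_toReal hK, ← ENNReal.ofReal_mul (inv_nonneg.2 hCpos.le)]
          refine ENNReal.ofReal_le_ofReal ?_
          rw [hC, inv_div, div_mul_eq_mul_div, div_le_iff₀ (by positivity)]
          nlinarith
  have hmem : MemLp b' 1 ν := hui.memLp_of_ae_tendsto (u := atTop) hlim
  exact tendsto_integral_of_L1' b' hmem.1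
    (Eventually.of_forall fun n => memLp_one_iff_integrable.1 (hui.memLp n))
    (tendsto_Lp_finite_of_tendsto_ae le_rfl ENNReal.one_ne_top hb hmem hui.unifIntegrable hlim)

/-- If `aₙ` converges pointwise and the exponential moments of `aₙ - mₙ` are bounded, then the
centerings `mₙ` are bounded. -/
theorem exists_abs_le_of_exp_moment_le (hν : ν ≠ 0) {a : ℕ → α → ℝ} {a' : α → ℝ} {m : ℕ → ℝ}
    (ha : ∀ n, AEMeasurable (a n) ν)
    (hlim : ∀ᵐ y ∂ν, Tendsto (fun n => a n y) atTop (𝓝 (a' y)))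
    {lam : ℝ} (hlam : 0 < lam) {K : ℝ≥0∞} (hK : K ≠ ∞)
    (hle : ∀ n, ∫⁻ y, ENNReal.ofReal (Real.exp (lam * |a n y - m n|)) ∂ν ≤ K) :
    ∃ M : ℝ, ∀ n, |m n| ≤ M := by
  by_contra! hcon
  -- Finitely many terms cannot make a real sequence unbounded, so every level is exceeded
  -- infinitely often.
  have hfreq : ∀ k : ℕ, ∃ᶠ n in atTop, (k : ℝ) < |m n| := by
    intro k hk
    have hbdd : IsBoundedUnder (· ≤ ·) atTop fun n => |m n| :=
      isBoundedUnder_of_eventually_le (a := (k : ℝ)) (hk.mono fun n hn => not_lt.1 hn)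
    obtain ⟨M, hM⟩ := hbdd.bddAbove_range
    obtain ⟨n, hn⟩ := hcon M
    exact absurd (hM ⟨n, rfl⟩) (not_le.2 hn)
  obtain ⟨φ, hφ, hφm⟩ := extraction_forall_of_frequently hfreq
  have hm : Tendsto (fun k => |m (φ k)|) atTop atTop :=
    tendsto_atTop_mono (fun k => (hφm k).le) tendsto_natCast_atTop_atTop
  have htop : ∀ᵐ y ∂ν,
      liminf (fun k => ENNReal.ofReal (Real.exp (lam * |a (φ k) y - m (φ k)|))) atTop = ∞ := by
    filter_upwards [hlim] with y hy
    refine Tendsto.liminf_eq (ENNReal.tendsto_ofReal_atTop.comp (Real.tendsto_exp_atTop.comp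
      (Tendsto.const_mul_atTop hlam ?_)))
    have h1 : Tendsto (fun k => -|a (φ k) y|) atTop (𝓝 (-|a' y|)) :=
      ((hy.comp hφ.tendsto_atTop).abs).neg
    refine tendsto_atTop_mono (fun k => ?_) (h1.add_atTop hm)
    have := abs_sub_abs_le_abs_sub (m (φ k)) (a (φ k) y)
    rw [abs_sub_comm] at this
    linarith
  -- The liminf is infinite almost everywhere and `ν ≠ 0`, so Fatou contradicts the finite bound
  -- `K`.
  have hfatou := lintegral_liminf_le' (μ := ν) (u := atTop)
    (f := fun k y => ENNReal.ofReal (Real.exp (lam * |a (φ k) y - m (φ k)|)))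
    (fun k => by have := ha (φ k); fun_prop)
  rw [lintegral_congr_ae htop, lintegral_const,
    ENNReal.top_mul (Measure.measure_univ_ne_zero.2 hν)] at hfatou
  have hlt : liminf (fun k => ∫⁻ y, ENNReal.ofReal
      (Real.exp (lam * |a (φ k) y - m (φ k)|)) ∂ν) atTop ≤ K :=
    (liminf_le_liminf (Eventually.of_forall fun k => hle (φ k))).trans_eq (liminf_const K)
  exact hK (top_le_iff.1 (hfatou.trans hlt))

/-- Convergence of `∫ ρₙ aₙ` for bounded `ρₙ → ρ` and `aₙ → a` pointwise, when the exponential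
moments of `aₙ`, after some centering, are bounded. -/
theorem tendsto_integral_mul_of_exp_moment_le [IsFiniteMeasure ν] (hν : ν ≠ 0)
    {a ρ : ℕ → α → ℝ} {a' ρ' : α → ℝ} {m : ℕ → ℝ}
    (ha : ∀ n, AEMeasurable (a n) ν) (hρ : ∀ n, AEMeasurable (ρ n) ν)
    (ha_lim : ∀ᵐ y ∂ν, Tendsto (fun n => a n y) atTop (𝓝 (a' y)))
    (hρ_lim : ∀ᵐ y ∂ν, Tendsto (fun n => ρ n y) atTop (𝓝 (ρ' y)))
    {R : ℝ} (hR : ∀ n, ∀ᵐ y ∂ν, |ρ n y| ≤ R)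
    {lam : ℝ} (hlam : 0 < lam) {K : ℝ≥0∞} (hK : K ≠ ∞)
    (hle : ∀ n, ∫⁻ y, ENNReal.ofReal (Real.exp (lam * |a n y - m n|)) ∂ν ≤ K) :
    Tendsto (fun n => ∫ y, ρ n y * a n y ∂ν) atTop (𝓝 (∫ y, ρ' y * a' y ∂ν)) := by
  obtain ⟨M, hM⟩ := exists_abs_le_of_exp_moment_le hν ha ha_lim hlam hK hle
  -- The constants come from `a² ≤ 2(a - m)² + 2m²` and `t² / 2 ≤ exp t` at `t = lam * |a - m|`.
  refine tendsto_integral_of_sq_lintegral_le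
    (K := ENNReal.ofReal (R ^ 2 * (4 / lam ^ 2)) * K +
      ENNReal.ofReal (R ^ 2 * (2 * M ^ 2)) * ν univ)
    (fun n => ((hρ n).mul (ha n)).aestronglyMeasurable) ?_ ?_ fun n => ?_
  · filter_upwards [ha_lim, hρ_lim] with y h1 h2 using h2.mul h1
  · exact ENNReal.add_ne_top.2 ⟨ENNReal.mul_ne_top ENNReal.ofReal_ne_top hK,
      ENNReal.mul_ne_top ENNReal.ofReal_ne_top (measure_ne_top _ _)⟩
  calc ∫⁻ y, ENNReal.ofReal ((ρ n y * a n y) ^ 2) ∂ν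
      ≤ ∫⁻ y, (ENNReal.ofReal (R ^ 2 * (4 / lam ^ 2)) *
          ENNReal.ofReal (Real.exp (lam * |a n y - m n|)) +
          ENNReal.ofReal (R ^ 2 * (2 * M ^ 2))) ∂ν := by
        refine lintegral_mono_ae ?_
        filter_upwards [hR n] with y hy
        rw [← ENNReal.ofReal_mul (by positivity), ← ENNReal.ofReal_add (by positivity)
          (by positivity)]
        refine ENNReal.ofReal_le_ofReal ?_
        have h1 : ρ n y ^ 2 ≤ R ^ 2 := sq_le_sq' (abs_le.1 hy).1 (abs_le.1 hy).2
        have h2 : m n ^ 2 ≤ M ^ 2 := sq_le_sq' (abs_le.1 (hM n)).1 (abs_le.1 (hM n)).2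
        have h3 : (lam * |a n y - m n|) ^ 2 / 2 ≤ Real.exp (lam * |a n y - m n|) := by
          have h := Real.quadratic_le_exp_of_nonneg
            (mul_nonneg hlam.le (abs_nonneg (a n y - m n)))
          have h0 := mul_nonneg hlam.le (abs_nonneg (a n y - m n))
          linarith
        have h4 : 2 * (a n y - m n) ^ 2 ≤ 4 / lam ^ 2 * Real.exp (lam * |a n y - m n|) := by
          rw [mul_pow, sq_abs] at h3
          rw [div_mul_eq_mul_div, le_div_iff₀ (by positivity)]
          linarith
        have h5 : a n y ^ 2 ≤ 4 / lam ^ 2 * Real.exp (lam * |a n y - m n|) + 2 * M ^ 2 := by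
          -- The hint is the identity `2(a - m)² + 2m² - a² = (a - 2m)²`.
          nlinarith [sq_nonneg (a n y - 2 * m n)]
        calc (ρ n y * a n y) ^ 2 = ρ n y ^ 2 * a n y ^ 2 := mul_pow _ _ _
          _ ≤ R ^ 2 * (4 / lam ^ 2 * Real.exp (lam * |a n y - m n|) + 2 * M ^ 2) :=
              mul_le_mul h1 h5 (sq_nonneg _) (sq_nonneg _)
          _ = _ := by ring
    _ = ENNReal.ofReal (R ^ 2 * (4 / lam ^ 2)) *
          ∫⁻ y, ENNReal.ofReal (Real.exp (lam * |a n y - m n|)) ∂ν +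
          ENNReal.ofReal (R ^ 2 * (2 * M ^ 2)) * ν univ := by
        rw [lintegral_add_right _ measurable_const, lintegral_const,
          lintegral_const_mul' _ _ ENNReal.ofReal_ne_top]
    _ ≤ _ := by
        gcongr
        exact hle n

end Integration

/-! ### Density bounds and continuity of the objective -/

namespace Problem

variable {d₁ d₂ dx dy Ξ : ℕ} {Ω : Type*} [MeasurableSpace Ω] {P : Measure Ω}
  {p : Problem d₁ d₂ dx dy Ξ} {S : Data d₁ d₂ dx dy Ω}

/-- The samples have law `jointLaw`, which is therefore a probability measure, and no factor of its
supporting product can be null. -/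
theorem Regular.volume_ne_zero [IsProbabilityMeasure P] (h : p.Regular P S) :
    volume p.Z₂ ≠ 0 ∧ volume p.Y ≠ 0 := by
  have hprob : IsProbabilityMeasure p.jointLaw :=
    h.law_S 0 ▸ Measure.isProbabilityMeasure_map (h.measurable_S 0).aemeasurable
  have hvol : volume (p.Z ×ˢ p.X ×ˢ p.Y) ≠ 0 := fun h0 => by
    refine IsProbabilityMeasure.ne_zero p.jointLaw ?_
    rw [jointLaw, Measure.restrict_eq_zero.2 h0, withDensity_zero_left]
  rw [Z, Measure.volume_eq_prod, Measure.prod_prod, Measure.volume_eq_prod, Measure.prod_prod,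
    Measure.volume_eq_prod, Measure.prod_prod] at hvol
  constructor <;> intro h0 <;> simp [h0] at hvol

/-- The point `z` makes `Z₁` non-empty, so that `Z₂` is a projection of `Z`. -/
theorem Regular.compact_Z₂ (h : p.Regular P S) {z : Dec d₁ d₂} (hz : z ∈ p.Z) :
    IsCompact p.Z₂ := by
  have := h.compact_Z.image continuous_snd
  rwa [Z, snd_image_prod ⟨z.1, hz.1⟩] at this

theorem Regular.continuousOn_dens_out (h : p.Regular P S) {z : Dec d₁ d₂} (hz : z ∈ p.Z)
    {x : Ctx dx} (hx : x ∈ p.X) : ContinuousOn (p.dens z x) p.Y :=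
  h.dens_continuous.comp (f := fun y : Out dy => (z, x, y)) (by fun_prop)
    fun _ hy => ⟨hz, hx, hy⟩

theorem Regular.continuousOn_dens_dec (h : p.Regular P S) {x : Ctx dx} (hx : x ∈ p.X)
    {y : Out dy} (hy : y ∈ p.Y) : ContinuousOn (fun z => p.dens z x y) p.Z :=
  h.dens_continuous.comp (f := fun z : Dec d₁ d₂ => (z, x, y)) (by fun_prop)
    fun _ hz => ⟨hz, hx, hy⟩

theorem Regular.continuousOn_marg (h : p.Regular P S) {x : Ctx dx} (hx : x ∈ p.X) :
    ContinuousOn (fun z => p.marg z x) p.Z :=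
  h.marg_smooth.continuousOn.comp (f := fun z : Dec d₁ d₂ => (z, x)) (by fun_prop)
    fun _ hz => ⟨hz, hx⟩

/-- Bounds of an integral over a set of finite measure from bounds of the integrand. -/
theorem setIntegral_mem_Icc {E : Type*} [MeasurableSpace E] {μ : Measure E} {s : Set E}
    (hs : MeasurableSet s) (hμ : μ s ≠ ∞) {f : E → ℝ} (hf : IntegrableOn f s μ) {c C : ℝ}
    (hfc : ∀ t ∈ s, c ≤ f t ∧ f t ≤ C) :
    ∫ t in s, f t ∂μ ∈ Icc (c * μ.real s) (C * μ.real s) := by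
  have hconst : ∀ r : ℝ, ∫ _ in s, r ∂μ = r * μ.real s := fun r => by
    rw [setIntegral_const, smul_eq_mul, mul_comm]
  constructor
  · rw [← hconst]
    exact setIntegral_mono_on (integrableOn_const hμ) hf hs fun t ht => (hfc t ht).1
  · rw [← hconst]
    exact setIntegral_mono_on hf (integrableOn_const hμ) hs fun t ht => (hfc t ht).2

/-- The marginal density is bounded and bounded away from zero. -/
theorem Regular.marg_mem_Icc (h : p.Regular P S) {c C : ℝ}
    (hcC : ∀ z ∈ p.Z, ∀ x ∈ p.X, ∀ y ∈ p.Y, c < p.dens z x y ∧ p.dens z x y < C)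
    {z : Dec d₁ d₂} (hz : z ∈ p.Z) {x : Ctx dx} (hx : x ∈ p.X) :
    p.marg z x ∈ Icc (c * volume.real p.Y) (C * volume.real p.Y) :=
  setIntegral_mem_Icc h.compact_Y.measurableSet h.compact_Y.measure_lt_top.ne
    ((h.continuousOn_dens_out hz hx).integrableOn_compact h.compact_Y)
    fun y hy => ⟨(hcC z hz x hx y hy).1.le, (hcC z hz x hx y hy).2.le⟩

theorem Regular.volume_real_Y_pos [IsProbabilityMeasure P] (h : p.Regular P S) :
    0 < volume.real p.Y :=
  ENNReal.toReal_pos h.volume_ne_zero.2 h.compact_Y.measure_lt_top.ne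

/-- Lebesgue measure on the outcome space is dominated, uniformly in `z₁`, by the conditional
laws given `Z₁ = z₁` and `X = x`. -/
theorem Regular.exists_smul_le_condLaw₁ [IsProbabilityMeasure P] (h : p.Regular P S) :
    ∃ κ : ℝ≥0∞, κ ≠ 0 ∧ κ ≠ ∞ ∧ ∀ z ∈ p.Z, ∀ x ∈ p.X,
      κ • volume.restrict p.Y ≤ p.condLaw₁ z.1 x := by
  obtain ⟨c, C, hc, hcC⟩ := h.dens_bounds
  rcases p.Z.eq_empty_or_nonempty with hZ | ⟨z₀, hz₀⟩
  · exact ⟨1, one_ne_zero, ENNReal.one_ne_top, by simp [hZ]⟩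
  rcases p.X.eq_empty_or_nonempty with hX | ⟨x₀, hx₀⟩
  · exact ⟨1, one_ne_zero, ENNReal.one_ne_top, by simp [hX]⟩
  have hvY := h.volume_real_Y_pos
  have hZ₂ := h.compact_Z₂ hz₀
  have hvZ : 0 < volume.real p.Z₂ :=
    ENNReal.toReal_pos h.volume_ne_zero.1 hZ₂.measure_lt_top.ne
  have hC : 0 < C := by
    obtain ⟨y, hy⟩ : p.Y.Nonempty := nonempty_of_measure_ne_zero h.volume_ne_zero.2
    have := hcC z₀ hz₀ x₀ hx₀ y hy
    linarith
  -- The numerator of the density is at least `c * vol Z₂`, the denominator at most `C * vol Y * vol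
  -- Z₂`; `vol Z₂` cancels.
  refine ⟨ENNReal.ofReal (c / (C * volume.real p.Y)), ?_, ENNReal.ofReal_ne_top, ?_⟩
  · exact (ENNReal.ofReal_pos.2 (by positivity)).ne'
  intro z hz x hx
  rw [← withDensity_const, condLaw₁]
  refine withDensity_mono ?_
  filter_upwards [ae_restrict_mem h.compact_Y.measurableSet] with y hy
  refine ENNReal.ofReal_le_ofReal ?_
  have hmaps : MapsTo (fun z₂ : EuclideanSpace ℝ (Fin d₂) => (z.1, z₂)) p.Z₂ p.Z :=
    fun z₂ hz₂ => ⟨hz.1, hz₂⟩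
  have hnum := (setIntegral_mem_Icc (μ := volume) hZ₂.measurableSet hZ₂.measure_lt_top.ne
    (((h.continuousOn_dens_dec hx hy).comp (by fun_prop) hmaps).integrableOn_compact hZ₂)
    (fun z₂ hz₂ => ⟨(hcC _ (hmaps hz₂) x hx y hy).1.le, (hcC _ (hmaps hz₂) x hx y hy).2.le⟩)).1
  have hden := setIntegral_mem_Icc (μ := volume) hZ₂.measurableSet hZ₂.measure_lt_top.ne
    (((h.continuousOn_marg hx).comp (by fun_prop) hmaps).integrableOn_compact hZ₂)
    (fun z₂ hz₂ => h.marg_mem_Icc hcC (hmaps hz₂) hx)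
  have hden_pos : 0 < ∫ z₂ in p.Z₂, p.marg (z.1, z₂) x :=
    lt_of_lt_of_le (by positivity) hden.1
  calc c / (C * volume.real p.Y)
      = c * volume.real p.Z₂ / (C * volume.real p.Y * volume.real p.Z₂) := by
        field_simp
    _ ≤ _ := div_le_div₀ (le_trans (by positivity) hnum) hnum hden_pos hden.2

/-- The objective as an integral with respect to Lebesgue measure. -/
theorem Regular.L_eq_setIntegral [IsProbabilityMeasure P] (h : p.Regular P S)
    {z : Dec d₁ d₂} (hz : z ∈ p.Z) {x : Ctx dx} (hx : x ∈ p.X) :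
    p.L z x = ∫ y in p.Y, p.dens z x y / p.marg z x * p.loss z y := by
  obtain ⟨c, C, hc, hcC⟩ := h.dens_bounds
  have hm : 0 < p.marg z x :=
    lt_of_lt_of_le (mul_pos hc h.volume_real_Y_pos) (h.marg_mem_Icc hcC hz hx).1
  rw [L, condLaw, integral_withDensity_eq_integral_toReal_smul₀]
  · refine setIntegral_congr_fun h.compact_Y.measurableSet fun y hy => ?_
    have := hc.trans (hcC z hz x hx y hy).1
    simp only [smul_eq_mul]
    rw [ENNReal.toReal_ofReal (by positivity)]
  · exact (((h.continuousOn_dens_out hz hx).aemeasurable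
      h.compact_Y.measurableSet).div_const _).ennreal_ofReal
  · exact Eventually.of_forall fun _ => ENNReal.ofReal_lt_top

theorem EquiCont.continuousOn {h : Dec d₁ d₂ → Out dy → ℝ} (hh : p.EquiCont h) {y : Out dy}
    (hy : y ∈ p.Y) : ContinuousOn (fun z => h z y) p.Z := by
  refine Metric.continuousOn_iff.2 fun z hz ε hε => ?_
  obtain ⟨δ, hδ, hδ'⟩ := hh z hz y hy (ε / 2) (half_pos hε)
  refine ⟨δ, hδ, fun z' hz' hd => ?_⟩
  have := hδ' z' hz' (by rw [← dist_eq_norm, dist_comm]; exact hd.le)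
  rw [Real.dist_eq, abs_sub_comm]
  linarith

/-- The objective is continuous in the decision. -/
theorem Regular.continuousOn_L [IsProbabilityMeasure P] (h : p.Regular P S)
    (hmeas : p.MeasurableData) (hloss : p.EquiCont p.loss) (htails : p.BoundedTails)
    {x : Ctx dx} (hx : x ∈ p.X) : ContinuousOn (fun z => p.L z x) p.Z := by
  obtain ⟨c, C, hc, hcC⟩ := h.dens_bounds
  obtain ⟨κ, hκ0, hκ, hκle⟩ := h.exists_smul_le_condLaw₁
  obtain ⟨lam, hlam, hK⟩ := htails
  have hYm := h.compact_Y.measurableSet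
  have hvY := h.volume_real_Y_pos
  have hfin : IsFiniteMeasure (volume.restrict p.Y) :=
    isFiniteMeasure_restrict.2 h.compact_Y.measure_lt_top.ne
  have hmarg : ∀ z ∈ p.Z, c * volume.real p.Y ≤ p.marg z x := fun z hz =>
    (h.marg_mem_Icc hcC hz hx).1
  rw [continuousOn_iff_continuous_domRestrict, continuous_iff_seqContinuous]
  intro u z hu
  have hu' : Tendsto (fun n => (u n : Dec d₁ d₂)) atTop (𝓝[p.Z] z) :=
    tendsto_nhdsWithin_iff.2 ⟨(continuous_subtype_val.tendsto z).comp hu,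
      Eventually.of_forall fun n => (u n).2⟩
  simp only [Function.comp_def, domRestrict_apply]
  rw [h.L_eq_setIntegral z.2 hx]
  simp_rw [fun n => h.L_eq_setIntegral (u n).2 hx]
  refine tendsto_integral_mul_of_exp_moment_le
    (m := fun n => ∫ y', p.loss (u n) y' ∂(p.condLaw₁ (u n).1.1 x))
    (R := C / (c * volume.real p.Y)) (lam := lam) ?_ ?_ ?_ ?_ ?_ ?_ hlam
    (ENNReal.mul_ne_top (ENNReal.inv_ne_top.2 hκ0) hK.ne) fun n => ?_
  · exact Measure.restrict_eq_zero.not.2 h.volume_ne_zero.2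
  · exact fun n => (aemeasurable_restrict_iff_comap_subtype hYm).2 (hmeas.1 _ (u n).2).aemeasurable
  · exact fun n => ((h.continuousOn_dens_out (u n).2 hx).aemeasurable hYm).div_const _
  · filter_upwards [ae_restrict_mem hYm] with y hy
    -- Continuity at each fixed `y` suffices, although the modulus depends on `y`.
    exact (hloss.continuousOn hy z z.2).tendsto.comp hu'
  · filter_upwards [ae_restrict_mem hYm] with y hy
    refine Tendsto.div ((h.continuousOn_dens_dec hx hy z z.2).tendsto.comp hu')
      ((h.continuousOn_marg hx z z.2).tendsto.comp hu') ?_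
    exact (lt_of_lt_of_le (by positivity) (hmarg z z.2)).ne'
  · intro n
    filter_upwards [ae_restrict_mem hYm] with y hy
    have hd := hcC (u n) (u n).2 x hx y hy
    have hd0 := hc.trans hd.1
    have hm := lt_of_lt_of_le (by positivity) (hmarg (u n) (u n).2)
    rw [abs_of_pos (by positivity)]
    exact div_le_div₀ (hd0.trans hd.2).le hd.2.le (by positivity) (hmarg (u n) (u n).2)
  -- Domination turns the bounded-tails supremum into a Lebesgue bound at the cost of a factor
  -- `κ⁻¹`.
  · rw [← ENNReal.mul_le_iff_le_inv hκ0 hκ, ← smul_eq_mul, ← lintegral_smul_measure]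
    refine (lintegral_mono' (hκle (u n) (u n).2 x hx) le_rfl).trans ?_
    exact le_iSup₂_of_le (u n : Dec d₁ d₂) (u n).2 (le_iSup₂_of_le x hx le_rfl)

end Problem

/-! ### From pointwise control by errors to both modes of convergence -/

section Control

variable {Ω ι E : Type*}

/-- `Q N ω` is, for large `N`, as close to `q` as desired wherever the errors `D i N ω` are small
enough. -/
def ControlledBy [EDist E] (D : ι → ℕ → Ω → ℝ≥0∞) (Q : ℕ → Ω → E) (q : E) : Prop :=
  ∀ η : ℝ≥0∞, 0 < η → ∃ δ : ℝ≥0∞, 0 < δ ∧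
    ∀ᶠ N in atTop, ∀ ω, (∀ i, D i N ω < δ) → edist (Q N ω) q < η

variable {D : ι → ℕ → Ω → ℝ≥0∞}

theorem ControlledBy.tendsto [Finite ι] [PseudoEMetricSpace E] {Q : ℕ → Ω → E} {q : E}
    (h : ControlledBy D Q q) {ω : Ω} (hD : ∀ i, Tendsto (fun N => D i N ω) atTop (𝓝 0)) :
    Tendsto (fun N => Q N ω) atTop (𝓝 q) := by
  refine EMetric.tendsto_nhds.2 fun η hη => ?_
  obtain ⟨δ, hδ, hQ⟩ := h η hη
  filter_upwards [hQ, eventually_all.2 fun i => (hD i).eventually_lt_const hδ] with N hN hDN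
  exact hN ω hDN

/-- A union bound over the finitely many errors. Only monotonicity and subadditivity of `P` enter,
so `Q` need not be measurable. -/
theorem ControlledBy.tendstoInMeasure [Finite ι] [EDist E] [MeasurableSpace Ω] {P : Measure Ω}
    {Q : ℕ → Ω → E} {q : E} (h : ControlledBy D Q q)
    (hD : ∀ i, ∀ ε : ℝ≥0∞, 0 < ε → Tendsto (fun N => P {ω | ε ≤ D i N ω}) atTop (𝓝 0)) :
    TendstoInMeasure P Q atTop fun _ => q := by
  have := Fintype.ofFinite ι
  intro η hη
  obtain ⟨δ, hδ, hQ⟩ := h η hη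
  have hsum : Tendsto (fun N => ∑ i, P {ω | δ ≤ D i N ω}) atTop (𝓝 0) := by
    simpa using tendsto_finsetSum Finset.univ fun i _ => hD i δ hδ
  refine tendsto_of_tendsto_of_tendsto_of_le_of_le' tendsto_const_nhds hsum
    (Eventually.of_forall fun _ => zero_le) ?_
  filter_upwards [hQ] with N hN
  refine (measure_mono fun ω hω => ?_).trans (measure_iUnion_fintype_le P _)
  rw [mem_iUnion]
  by_contra! hlt
  exact absurd (hN ω fun i => not_le.1 (hlt i)) (not_lt.2 hω)

end Control

/-! ### Selection of approximately feasible points -/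

namespace Problem

variable {d₁ d₂ dx dy Ξ : ℕ} {Ω : Type*}

/-- The uniform estimation errors of the objective (`none`) and of the constraints. -/
noncomputable def uniformError (p : Problem d₁ d₂ dx dy Ξ) (S : Data d₁ d₂ dx dy Ω)
    (w : Weights d₁ d₂ dx Ω) (x : Ctx dx) : Option (Fin Ξ) → ℕ → Ω → ℝ≥0∞
  | none, N, ω => p.supDist (fun z => p.L z x) fun z => p.Lhat S w N ω z x
  | some ξ, N, ω => p.supDist (fun z => p.g ξ z x) fun z => p.ghat S w ξ N ω z x

variable {p : Problem d₁ d₂ dx dy Ξ} {S : Data d₁ d₂ dx dy Ω} {w : Weights d₁ d₂ dx Ω}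

theorem edist_le_supDist (h h' : Dec d₁ d₂ → ℝ) {z : Dec d₁ d₂} (hz : z ∈ p.Z) :
    edist (h z) (h' z) ≤ p.supDist h h' := by
  rw [edist_dist, Real.dist_eq]
  exact le_iSup₂_of_le (f := fun z (_ : z ∈ p.Z) => ENNReal.ofReal |h z - h' z|) z hz le_rfl

/-- A strictly feasible decision is feasible for all sufficiently accurate approximations. -/
theorem exists_mem_Phat_of_uniformError_lt {x : Ctx dx} {z : Dec d₁ d₂} (hz : z ∈ p.Z)
    (hg : ∀ ξ, 1 - p.risk ξ < p.g ξ z x) :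
    ∃ δ : ℝ≥0∞, 0 < δ ∧ ∀ N ω, (∀ i, p.uniformError S w x i N ω < δ) →
      z ∈ p.Phat S w N ω x := by
  have hev : ∀ᶠ δ : ℝ in 𝓝[>] 0, ∀ ξ, δ < p.g ξ z x - (1 - p.risk ξ) :=
    eventually_all.2 fun ξ =>
      nhdsWithin_le_nhds (eventually_lt_nhds (sub_pos.2 (hg ξ)))
  obtain ⟨δ, hδ, hδ0⟩ := (hev.and self_mem_nhdsWithin).exists
  refine ⟨ENNReal.ofReal δ, ENNReal.ofReal_pos.2 hδ0, fun N ω hD => ⟨hz, fun ξ => ?_⟩⟩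
  have h1 : edist (p.g ξ z x) (p.ghat S w ξ N ω z x) < ENNReal.ofReal δ :=
    (edist_le_supDist (fun z => p.g ξ z x) (fun z => p.ghat S w ξ N ω z x) hz).trans_lt
      (hD (some ξ))
  rw [edist_lt_ofReal, Real.dist_eq] at h1
  linarith [(abs_lt.1 h1).2, hδ ξ]

/-- Nearly closest points of the approximate feasible sets to a limit of strictly feasible
decisions converge to it, and so do the true and the approximate objective there. -/
theorem exists_controlled_selection {x : Ctx dx} {zs : Dec d₁ d₂} (hzs : zs ∈ p.Z)
    (hL : ContinuousOn (fun z => p.L z x) p.Z)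
    (hslater : ∀ ε > 0, ∃ z ∈ p.Z, ‖z - zs‖ ≤ ε ∧ ∀ ξ, 1 - p.risk ξ < p.g ξ z x) :
    ∃ zn : ℕ → Ω → Dec d₁ d₂,
      (∀ N ω, (p.Phat S w N ω x).Nonempty → zn N ω ∈ p.Phat S w N ω x) ∧
      ControlledBy (p.uniformError S w x) zn zs ∧
      ControlledBy (p.uniformError S w x) (fun N ω => p.Lhat S w N ω (zn N ω) x) (p.L zs x) ∧
      ControlledBy (p.uniformError S w x) (fun N ω => p.L (zn N ω) x) (p.L zs x) := by
  -- The slack `1 / (N + 1)` replaces attainment of the distance; `zs` is a default value where the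
  -- set is empty.
  have hsel : ∀ N ω, ∃ z, (p.Phat S w N ω x).Nonempty → z ∈ p.Phat S w N ω x ∧
      dist zs z < Metric.infDist zs (p.Phat S w N ω x) + 1 / ((N : ℝ) + 1) := by
    intro N ω
    by_cases hne : (p.Phat S w N ω x).Nonempty
    · obtain ⟨z, hz, hd⟩ := (Metric.infDist_lt_iff hne).1
        (lt_add_of_pos_right (Metric.infDist zs (p.Phat S w N ω x))
          (Nat.one_div_pos_of_nat (α := ℝ) (n := N)))
      exact ⟨z, fun _ => ⟨hz, hd⟩⟩
    · exact ⟨zs, fun h => absurd h hne⟩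
  choose zn hzn using hsel
  have hclose : ∀ η : ℝ, 0 < η → ∃ δ : ℝ≥0∞, 0 < δ ∧ ∀ᶠ N in atTop, ∀ ω,
      (∀ i, p.uniformError S w x i N ω < δ) → zn N ω ∈ p.Z ∧ dist (zn N ω) zs < η := by
    intro η hη
    -- Half of `η` is spent on the strictly feasible competitor, half on the slack `1 / (N + 1)`.
    obtain ⟨z, hz, hzd, hg⟩ := hslater (η / 2) (half_pos hη)
    obtain ⟨δ, hδ, hmem⟩ := exists_mem_Phat_of_uniformError_lt (S := S) (w := w) hz hg
    refine ⟨δ, hδ, ?_⟩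
    filter_upwards [(tendsto_one_div_add_atTop_nhds_zero_nat (𝕜 := ℝ)).eventually_lt_const
      (half_pos hη)] with N hN ω hD
    have hzP := hmem N ω hD
    obtain ⟨hP, hd⟩ := hzn N ω ⟨z, hzP⟩
    have h1 := Metric.infDist_le_dist_of_mem (x := zs) hzP
    rw [dist_comm, dist_eq_norm] at h1
    refine ⟨hP.1, ?_⟩
    rw [dist_comm]
    linarith
  have hLclose : ∀ η : ℝ≥0∞, 0 < η → ∃ δ : ℝ≥0∞, 0 < δ ∧ ∀ᶠ N in atTop, ∀ ω,
      (∀ i, p.uniformError S w x i N ω < δ) →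
        zn N ω ∈ p.Z ∧ edist (p.L (zn N ω) x) (p.L zs x) < η := by
    intro η hη
    obtain ⟨r, hr, hball⟩ := Metric.mem_nhdsWithin_iff.1
      ((hL zs hzs).tendsto (Metric.eball_mem_nhds _ hη))
    obtain ⟨δ, hδ, hN⟩ := hclose r hr
    refine ⟨δ, hδ, hN.mono fun N hN ω hD => ⟨(hN ω hD).1, ?_⟩⟩
    exact hball ⟨(hN ω hD).2, (hN ω hD).1⟩
  refine ⟨zn, fun N ω hne => (hzn N ω hne).1, fun η hη => ?_, fun η hη => ?_, fun η hη => ?_⟩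
  · obtain ⟨r, hr0, hr⟩ := ENNReal.lt_iff_exists_real_btwn.1 hη
    obtain ⟨δ, hδ, hN⟩ := hclose r (ENNReal.ofReal_pos.1 hr.1)
    refine ⟨δ, hδ, hN.mono fun N hN ω hD => lt_trans ?_ hr.2⟩
    exact edist_lt_ofReal.2 (hN ω hD).2
  · obtain ⟨δ, hδ, hN⟩ := hLclose (η / 2) (ENNReal.half_pos hη.ne')
    refine ⟨min δ (η / 2), lt_min hδ (ENNReal.half_pos hη.ne'),
      hN.mono fun N hN ω hD => ?_⟩
    obtain ⟨hZ, hd⟩ := hN ω fun i => (hD i).trans_le (min_le_left _ _)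
    have he : edist (p.Lhat S w N ω (zn N ω) x) (p.L (zn N ω) x) < η / 2 := by
      rw [edist_comm]
      exact (edist_le_supDist (fun z => p.L z x) (fun z => p.Lhat S w N ω z x) hZ).trans_lt
        ((hD none).trans_le (min_le_right _ _))
    calc edist (p.Lhat S w N ω (zn N ω) x) (p.L zs x)
        ≤ edist (p.Lhat S w N ω (zn N ω) x) (p.L (zn N ω) x) +
            edist (p.L (zn N ω) x) (p.L zs x) := edist_triangle _ _ _
      _ < η / 2 + η / 2 := ENNReal.add_lt_add he hd
      _ = η := ENNReal.add_halves η
  · obtain ⟨δ, hδ, hN⟩ := hLclose η hη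
    exact ⟨δ, hδ, hN.mono fun N hN ω hD => (hN ω hD).2⟩

end Problem

end CCDDU

/-! ### Accuracy and optimality, almost surely and in probability -/

theorem theorem2 {d₁ d₂ dx dy Ξ : ℕ} {Ω : Type*} [MeasurableSpace Ω]
    (P : Measure Ω) [IsProbabilityMeasure P]
    (p : CCDDU.Problem d₁ d₂ dx dy Ξ)
    (hrisk : ∀ ξ, p.risk ξ ∈ Set.Ioo (0 : ℝ) 1)
    (hmeas : p.MeasurableData)
    (Zr : Ω → CCDDU.Dec d₁ d₂) (Xr : Ω → CCDDU.Ctx dx)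
    (Yr : CCDDU.Dec d₁ d₂ → Ω → CCDDU.Out dy)
    (S : CCDDU.Data d₁ d₂ dx dy Ω) (w : CCDDU.Weights d₁ d₂ dx Ω)
    (hdecomp : p.DecompIgn P Zr Xr Yr)
    (hloss : p.EquiCont p.loss) (hcon : ∀ ξ, p.EquiCont (p.con ξ))
    (hreg : p.Regular P S)
    (hexist : p.Existence P S w)
    (htails : p.BoundedTails)
    (hslater : p.Slater)
    (hwass : p.WassersteinLipschitz)
    (hdens : p.BoundedDensities) :
    (p.StrongWeights P S w →
      ∀ x ∈ p.X, ∃ zstar, p.IsOptimal x zstar ∧ ∃ zn : ℕ → Ω → CCDDU.Dec d₁ d₂,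
        (∀ᵐ ω ∂P, ∀ N ≥ 1, zn N ω ∈ p.Phat S w N ω x) ∧
        (∀ᵐ ω ∂P, Tendsto (fun N => zn N ω) atTop (𝓝 zstar)) ∧
        (∀ᵐ ω ∂P, Tendsto (fun N => p.Lhat S w N ω (zn N ω) x) atTop (𝓝 (p.L zstar x))) ∧
        (∀ᵐ ω ∂P, Tendsto (fun N => p.L (zn N ω) x) atTop (𝓝 (p.L zstar x)))) ∧
    (p.WeakWeights P S w →
      ∀ x ∈ p.X, ∃ zstar, p.IsOptimal x zstar ∧ ∃ zn : ℕ → Ω → CCDDU.Dec d₁ d₂,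
        (∀ᵐ ω ∂P, ∀ N ≥ 1, zn N ω ∈ p.Phat S w N ω x) ∧
        TendstoInMeasure P zn atTop (fun _ => zstar) ∧
        TendstoInMeasure P (fun N ω => p.Lhat S w N ω (zn N ω) x) atTop
          (fun _ => p.L zstar x) ∧
        TendstoInMeasure P (fun N ω => p.L (zn N ω) x) atTop (fun _ => p.L zstar x)) := by
  have hselect : ∀ x ∈ p.X, ∃ zstar, p.IsOptimal x zstar ∧ ∃ zn : ℕ → Ω → CCDDU.Dec d₁ d₂,
      (∀ᵐ ω ∂P, ∀ N ≥ 1, zn N ω ∈ p.Phat S w N ω x) ∧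
      CCDDU.ControlledBy (p.uniformError S w x) zn zstar ∧
      CCDDU.ControlledBy (p.uniformError S w x) (fun N ω => p.Lhat S w N ω (zn N ω) x)
        (p.L zstar x) ∧
      CCDDU.ControlledBy (p.uniformError S w x) (fun N ω => p.L (zn N ω) x) (p.L zstar x) := by
    intro x hx
    obtain ⟨zs, hopt, hzs⟩ := hslater x hx
    obtain ⟨zn, hmem, hctrl⟩ := CCDDU.Problem.exists_controlled_selection (S := S) (w := w)
      hopt.1.1 (hreg.continuousOn_L hmeas hloss htails hx) hzs
    refine ⟨zs, hopt, zn, ?_, hctrl⟩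
    filter_upwards [hexist x hx] with ω hω N hN using hmem N ω (hω N hN).1
  constructor
  · intro hw x hx
    obtain ⟨zs, hopt, zn, hmem, hz, hLhat, hL⟩ := hselect x hx
    have hD : ∀ᵐ ω ∂P, ∀ i, Tendsto (fun N => p.uniformError S w x i N ω) atTop (𝓝 0) := by
      refine ae_all_iff.2 fun i => ?_
      cases i with
      | none => exact hw.1 x hx
      | some ξ => exact hw.2 ξ x hx
    exact ⟨zs, hopt, zn, hmem, hD.mono fun ω hω => hz.tendsto hω,
      hD.mono fun ω hω => hLhat.tendsto hω, hD.mono fun ω hω => hL.tendsto hω⟩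
  · intro hw x hx
    obtain ⟨zs, hopt, zn, hmem, hz, hLhat, hL⟩ := hselect x hx
    have hD : ∀ i, ∀ ε : ℝ≥0∞, 0 < ε →
        Tendsto (fun N => P {ω | ε ≤ p.uniformError S w x i N ω}) atTop (𝓝 0) := by
      intro i
      cases i with
      | none => exact hw.1 x hx
      | some ξ => exact hw.2 ξ x hx
    exact ⟨zs, hopt, zn, hmem, hz.tendstoInMeasure hD, hLhat.tendstoInMeasure hD,
      hL.tendstoInMeasure hD⟩
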